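/- All graphs are finite, simple and undirected. For a graph $G$ let $\omega(G)$ be its clique number and $\mathrm{tw}(G)$ its treewidth (with value $0$ for the graph with no vertices). A graph $H$ is an induced minor of $G$ if it can be obtained from $G$ by a sequence of vertex deletions and edge contractions; equivalently, there are pairwise disjoint nonempty sets $X_u \subseteq V(G)$, $u\in V(H)$, each inducing a connected subgraph of $G$, such that for all distinct $u,v\in V(H)$ there is an edge of $G$ between $X_u$ and $X_v$ if and only if $uv\in E(H)$. A graph is $H$-induced-minor-free if $H$ is not an induced minor of it. A function $f:\mathbb{N}\to\mathbb{N}$ is a $(\mathrm{tw},\omega)$-binding function for a class $\mathcal{G}$ of graphs if $\mathrm{tw}(G')\le f(\omega(G'))$ for every $G\in\mathcal{G}$ and every induced subgraph $G'$ of $G$; the class is $(\mathrm{tw},\omega)$-bounded if it has such a function. Let $R(k,\ell)$ be the least positive integer such that every graph with at least $R(k,\ell)$ vertices contains a clique of size $k$ or an independent set of size $\ell$. **Lemma.** For every $q\in\mathbb{N}=\{0,1,2,\dots\}$, the class of $K_{2,q}$-induced-minor-free graphs is $(\mathrm{tw},\omega)$-bounded, with binding function $$f(k)=\max\{k,\;2R(k+1,q)-2\}-1,$$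 where, for $k=0$ (the graph with no vertices), a value $-1$ of the right-hand side is read as $0$. -/

import Mathlib

universe u v w

namespace TwOmega

/-- A tree decomposition of a graph `G`: a finite tree together with a bag (a set of vertices
of `G`) at each node of the tree.  Trees on all finite types in `Type` suffice, since every finite
tree is isomorphic to one of these. -/
structure TreeDecomposition {V : Type u} (G : SimpleGraph V) where
  /-- the nodes of the tree -/
  Node : Type
  finite_node : Finite Node
  /-- the tree -/
  tree : SimpleGraph Node
  isTree : tree.IsTree
  /-- the bags -/
  bag : Node → Set V
  /-- the bags cover the vertex set -/
  iUnion_bag : ⋃ t, bag t = Set.univ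
  /-- every edge is contained in a bag -/
  exists_bag_of_adj : ∀ a b : V, G.Adj a b → ∃ t, a ∈ bag t ∧ b ∈ bag t
  /-- the nodes whose bags contain a given vertex induce a connected subtree -/
  connected_nodes : ∀ a : V, (tree.induce {t | a ∈ bag t}).Connected

/-- The width of a tree decomposition: the maximum size of a bag, minus one.  The subtraction
truncates only if all bags are empty, that is, if the graph has no vertices. -/
noncomputable def TreeDecomposition.width {V : Type u} {G : SimpleGraph V}
    (D : TreeDecomposition G) : ℕ :=
  (⨆ t : D.Node, (D.bag t).ncard) - 1

/-- The treewidth of a (finite) graph: the minimum width of a tree decomposition. The graph with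
no vertices has treewidth `0` here. -/
noncomputable def treewidth {V : Type u} (G : SimpleGraph V) : ℕ :=
  sInf {n : ℕ | ∃ D : TreeDecomposition G, D.width = n}

/-- An induced minor model of `H` in `G`: pairwise disjoint connected (in particular nonempty)
bags in `G`, indexed by the vertices of `H`, such that there is an edge of `G` between two distinct
bags if and only if the two vertices of `H` are adjacent. -/
structure InducedMinorModel {W : Type w} {V : Type v} (H : SimpleGraph W) (G : SimpleGraph V) where
  /-- the bags -/
  bag : W → Set V
  disjoint_bag : ∀ a b : W, a ≠ b → Disjoint (bag a) (bag b)
  connected_bag : ∀ a : W, (G.induce (bag a)).Connected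
  adj_iff : ∀ a b : W, a ≠ b → ((∃ x ∈ bag a, ∃ y ∈ bag b, G.Adj x y) ↔ H.Adj a b)

/-- `H` is an induced minor of `G`. -/
def IsInducedMinor {W : Type w} {V : Type v} (H : SimpleGraph W) (G : SimpleGraph V) : Prop :=
  Nonempty (InducedMinorModel H G)

/-- The Ramsey number `R(k, l)`: the least positive integer `N` such that every finite graph with
at least `N` vertices has a clique of size `k` or an independent set of size `l`. -/
noncomputable def ramseyNumber (k l : ℕ) : ℕ :=
  sInf {N : ℕ | 0 < N ∧ ∀ n : ℕ, N ≤ n → ∀ G : SimpleGraph (Fin n),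
    (∃ s : Finset (Fin n), G.IsNClique k s) ∨ (∃ s : Finset (Fin n), G.IsNIndepSet l s)}

/-- A class of graphs; only its finite members are considered below. -/
def GraphClass : Type (u + 1) := ∀ V : Type u, SimpleGraph V → Prop

/-- `f` is a `(tw, ω)`-binding function for the class `𝒢` of finite graphs: every induced subgraph
`G'` of every member of `𝒢` satisfies `tw(G') ≤ f(ω(G'))`. -/
def IsTwOmegaBindingFunction (𝒢 : GraphClass.{u}) (f : ℕ → ℕ) : Prop :=
  ∀ (V : Type u) [Finite V] (G : SimpleGraph V), 𝒢 V G →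
    ∀ S : Set V, treewidth (G.induce S) ≤ f (G.induce S).cliqueNum

/-- A class of graphs is `(tw, ω)`-bounded if it has a `(tw, ω)`-binding function. -/
def IsTwOmegaBounded (𝒢 : GraphClass.{u}) : Prop :=
  ∃ f : ℕ → ℕ, IsTwOmegaBindingFunction 𝒢 f

/-- The class of `H`-induced-minor-free graphs. -/
def inducedMinorFree {W : Type w} (H : SimpleGraph W) : GraphClass.{u} :=
  fun _ G => ¬ IsInducedMinor H G

end TwOmega

/-! Let `s = R(ω + 1, q) - 1`. If `A` and `B` are disjoint connected sets without edges between
them, then `q` independent common neighbours of `A` and `B` would form, with `A` and `B`, a model of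
`K_{2,q}`. By Ramsey's theorem `A` and `B` thus have at most `s` common neighbours
(`sepBounded_induce`). Skodinis' bound (`SepBounded.decomposable`) turns this into bags of size at
most `max ω (2 * s)`.

For that bound, cut along clique neighbourhoods until only atoms remain; by the Helly property a
clique lies in a bag on either side, so the pieces can be glued. In an atom, consider a connected
set `C` whose neighbourhood `S` is also seen entirely from a connected set `A` opposite to `C`; then
`S` has at most `s` vertices and is not a clique. Two nonadjacent `x`, `y` in `S` yield a set `T ⊆
C` of at most `s` neighbours of `x`. The bag `S ∪ T` splits `C` into smaller components, each of
which again has an opposite set (`decomposable_of_isOpposite`). -/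

namespace TwOmega

/-! ### Connected sets, components and common neighbours. -/

section Connectivity

variable {V : Type u} {G : SimpleGraph V}

/-- A set of vertices is connected if it is nonempty and no proper nonempty subset of it is closed
under adjacency within the set. -/
def SetConn (G : SimpleGraph V) (A : Set V) : Prop :=
  A.Nonempty ∧ ∀ X ⊆ A, X.Nonempty → (∀ x ∈ X, ∀ y ∈ A, G.Adj x y → y ∈ X) → A ⊆ X

lemma SetConn.connected {A : Set V} (h : SetConn G A) : (G.induce A).Connected := by
  obtain ⟨⟨a, ha⟩, h⟩ := h
  rw [SimpleGraph.connected_iff_exists_forall_reachable]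
  refine ⟨⟨a, ha⟩, ?_⟩
  have key := h {y | ∃ hy : y ∈ A, (G.induce A).Reachable ⟨a, ha⟩ ⟨y, hy⟩} (fun y hy => hy.1)
    ⟨a, ha, SimpleGraph.Reachable.refl _⟩ (by
      rintro x ⟨hx, hr⟩ y hy hxy
      refine ⟨hy, hr.trans (SimpleGraph.Adj.reachable ?_)⟩
      simpa using hxy)
  rintro ⟨w, hw⟩
  exact (key hw).2

lemma SetConn.singleton (x : V) : SetConn G {x} := by
  refine ⟨⟨x, rfl⟩, fun X hX hne _ => ?_⟩
  rw [(Set.subset_singleton_iff_eq.1 hX).resolve_left hne.ne_empty]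

lemma SetConn.union {A B : Set V} (hA : SetConn G A) (hB : SetConn G B) {a b : V} (ha : a ∈ A)
    (hb : b ∈ B) (hab : G.Adj a b) : SetConn G (A ∪ B) := by
  refine ⟨⟨a, .inl ha⟩, fun X hX ⟨z, hz⟩ hcl => ?_⟩
  have fA : (X ∩ A).Nonempty → A ⊆ X := fun hne =>
    (hA.2 (X ∩ A) Set.inter_subset_right hne
      fun x hx y hy hxy => ⟨hcl x hx.1 y (.inl hy) hxy, hy⟩).trans Set.inter_subset_left
  have fB : (X ∩ B).Nonempty → B ⊆ X := fun hne =>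
    (hB.2 (X ∩ B) Set.inter_subset_right hne
      fun x hx y hy hxy => ⟨hcl x hx.1 y (.inr hy) hxy, hy⟩).trans Set.inter_subset_left
  rcases hX hz with h | h
  · have h1 := fA ⟨z, hz, h⟩
    exact Set.union_subset h1 (fB ⟨b, hcl a (h1 ha) b (.inr hb) hab, hb⟩)
  · have h1 := fB ⟨z, hz, h⟩
    exact Set.union_subset (fA ⟨a, hcl b (h1 hb) a (.inl ha) hab.symm, ha⟩) h1

/-- The component of `v` in the subgraph induced by `W ∪ {v}`. -/
def comp (G : SimpleGraph V) (W : Set V) (v : V) : Set V :=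
  {y | Relation.ReflTransGen (fun a b => b ∈ W ∧ G.Adj a b) v y}

lemma self_mem_comp (W : Set V) (v : V) : v ∈ comp G W v := Relation.ReflTransGen.refl

lemma comp_closed {W : Set V} {v a b : V} (ha : a ∈ comp G W v) (hb : b ∈ W) (hab : G.Adj a b) :
    b ∈ comp G W v := Relation.ReflTransGen.tail ha ⟨hb, hab⟩

lemma comp_subset_of_closed {W X : Set V} {v : V} (hv : v ∈ X)
    (hX : ∀ x ∈ X, ∀ y ∈ W, G.Adj x y → y ∈ X) : comp G W v ⊆ X := by
  intro y hy
  induction hy with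
  | refl => exact hv
  | tail _ h ih => exact hX _ ih _ h.1 h.2

lemma comp_subset (W : Set V) (v : V) : comp G W v ⊆ insert v W :=
  comp_subset_of_closed (Set.mem_insert _ _) fun _ _ _ hy _ => .inr hy

lemma comp_subset_of_mem {W : Set V} {v : V} (hv : v ∈ W) : comp G W v ⊆ W :=
  comp_subset_of_closed hv fun _ _ _ hy _ => hy

/-- The component is the least closed set containing `v`. A closed part that misses `v` has, by
symmetry of adjacency, a closed complement containing `v`, hence is empty. -/
lemma setConn_comp (W : Set V) (v : V) : SetConn G (comp G W v) := by
  refine ⟨⟨v, self_mem_comp W v⟩, fun X hX ⟨z, hz⟩ hcl => ?_⟩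
  by_cases hv : v ∈ X
  · exact comp_subset_of_closed hv fun x hx y hy hxy =>
      hcl x hx y (comp_closed (hX hx) hy hxy) hxy
  · have : comp G W v ⊆ comp G W v \ X :=
      comp_subset_of_closed ⟨self_mem_comp W v, hv⟩ fun x hx y hy hxy =>
        ⟨comp_closed hx.1 hy hxy, fun hyX => hx.2 (hcl y hyX x hx.1 hxy.symm)⟩
    exact absurd hz (this (hX hz)).2

/-- The neighbourhood of `C` within `U`. -/
def boundary (G : SimpleGraph V) (U C : Set V) : Set V :=
  {v | v ∈ U ∧ v ∉ C ∧ ∃ c ∈ C, G.Adj v c}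

/-- The vertices with a neighbour in `A` and a neighbour in `B`. -/
def commonNbrs (G : SimpleGraph V) (A B : Set V) : Set V :=
  {v | (∃ a ∈ A, G.Adj v a) ∧ ∃ b ∈ B, G.Adj v b}

/-- Any two disjoint connected sets without edges between them have at most `s` common
neighbours.  Equivalently, all minimal separators of induced subgraphs have size at most `s`. -/
def SepBounded (G : SimpleGraph V) (s : ℕ) : Prop :=
  ∀ A B : Set V, SetConn G A → SetConn G B → Disjoint A B →
    (∀ a ∈ A, ∀ b ∈ B, ¬ G.Adj a b) → (commonNbrs G A B).ncard ≤ s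

end Connectivity

/-! ### Tree decompositions as families of bags, and gluing. -/

section BagFamily

variable {V : Type u} {G : SimpleGraph V}

/-- `BagFamily U F` says that `F` is the family of bags of a tree decomposition of the edgeless
graph on `U`, obtained by repeatedly joining two trees by an edge. -/
inductive BagFamily : Set V → Set (Set V) → Prop
  | single (b : Set V) : BagFamily b {b}
  | glue {U₁ U₂ : Set V} {F₁ F₂ : Set (Set V)} {c₁ c₂ : Set V} :
      BagFamily U₁ F₁ → BagFamily U₂ F₂ → c₁ ∈ F₁ → c₂ ∈ F₂ → U₁ ∩ U₂ ⊆ c₁ → U₁ ∩ U₂ ⊆ c₂ →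
      BagFamily (U₁ ∪ U₂) (F₁ ∪ F₂)

lemma BagFamily.subset {U : Set V} {F : Set (Set V)} (h : BagFamily U F) :
    ∀ b ∈ F, b ⊆ U := by
  induction h with
  | single b => simp
  | glue _ _ _ _ _ _ ih1 ih2 =>
    rintro b (hb | hb)
    · exact (ih1 b hb).trans Set.subset_union_left
    · exact (ih2 b hb).trans Set.subset_union_right

/-- The Helly property. -/
lemma BagFamily.helly {U : Set V} {F : Set (Set V)} (h : BagFamily U F) :
    ∀ K ⊆ U, (∀ x ∈ K, ∀ y ∈ K, ∃ b ∈ F, x ∈ b ∧ y ∈ b) → ∃ b ∈ F, K ⊆ b := by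
  induction h with
  | single b => exact fun K hK _ => ⟨b, rfl, hK⟩
  | @glue U₁ U₂ F₁ F₂ c₁ c₂ h1 h2 hc1 hc2 hs1 hs2 ih1 ih2 =>
    intro K hK hp
    by_cases hK1 : K ⊆ U₁
    -- Two vertices of `U₁` that share a bag of `F₂` lie in `U₁ ∩ U₂`, hence also in `c₁`.
    · obtain ⟨b, hb, hKb⟩ := ih1 K hK1 (by
        intro x hx y hy
        obtain ⟨b, hb | hb, hxb, hyb⟩ := hp x hx y hy
        · exact ⟨b, hb, hxb, hyb⟩
        · exact ⟨c₁, hc1, hs1 ⟨hK1 hx, h2.subset b hb hxb⟩, hs1 ⟨hK1 hy, h2.subset b hb hyb⟩⟩)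
      exact ⟨b, .inl hb, hKb⟩
    by_cases hK2 : K ⊆ U₂
    · obtain ⟨b, hb, hKb⟩ := ih2 K hK2 (by
        intro x hx y hy
        obtain ⟨b, hb | hb, hxb, hyb⟩ := hp x hx y hy
        · exact ⟨c₂, hc2, hs2 ⟨h1.subset b hb hxb, hK2 hx⟩, hs2 ⟨h1.subset b hb hyb, hK2 hy⟩⟩
        · exact ⟨b, hb, hxb, hyb⟩)
      exact ⟨b, .inr hb, hKb⟩
    obtain ⟨x, hx, hx1⟩ := Set.not_subset.1 hK1
    obtain ⟨y, hy, hy2⟩ := Set.not_subset.1 hK2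
    obtain ⟨b, hb | hb, hxb, hyb⟩ := hp x hx y hy
    · exact absurd (h1.subset b hb hxb) hx1
    · exact absurd (h2.subset b hb hyb) hy2

/-- `G[U]` has a tree decomposition with bags of size at most `m`, one of which contains `R`. -/
def Decomposable (G : SimpleGraph V) (m : ℕ) (U R : Set V) : Prop :=
  ∃ F, BagFamily U F ∧ (∀ b ∈ F, b.ncard ≤ m) ∧
    (∀ x ∈ U, ∀ y ∈ U, G.Adj x y → ∃ b ∈ F, x ∈ b ∧ y ∈ b) ∧ ∃ b ∈ F, R ⊆ b

lemma Decomposable.of_ncard_le {m : ℕ} {U : Set V} (h : U.ncard ≤ m) : Decomposable G m U U :=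
  ⟨{U}, .single U, by simpa using h, fun x hx y hy _ => ⟨U, rfl, hx, hy⟩, U, rfl, subset_rfl⟩

/-- The overlap lies in a bag on each side, so the trees can be joined there; `hadj` says that the
overlap separates. The root `R₁` survives, so that several pieces can be glued to one bag. -/
lemma Decomposable.glue {m : ℕ} {U₁ U₂ R₁ R₂ : Set V} (h1 : Decomposable G m U₁ R₁)
    (h2 : Decomposable G m U₂ R₂) (hs1 : U₁ ∩ U₂ ⊆ R₁) (hs2 : U₁ ∩ U₂ ⊆ R₂)
    (hadj : ∀ x ∈ U₁, ∀ y ∈ U₂, G.Adj x y → x ∈ U₂ ∨ y ∈ U₁) :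
    Decomposable G m (U₁ ∪ U₂) R₁ := by
  obtain ⟨F1, hF1, hm1, he1, c1, hc1, hR1⟩ := h1
  obtain ⟨F2, hF2, hm2, he2, c2, hc2, hR2⟩ := h2
  refine ⟨F1 ∪ F2, hF1.glue hF2 hc1 hc2 (hs1.trans hR1) (hs2.trans hR2), ?_, ?_,
    c1, .inl hc1, hR1⟩
  · rintro b (hb | hb)
    exacts [hm1 b hb, hm2 b hb]
  · have e1 : ∀ x ∈ U₁, ∀ y ∈ U₁, G.Adj x y → ∃ b ∈ F1 ∪ F2, x ∈ b ∧ y ∈ b := fun x hx y hy h =>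
      let ⟨b, hb, h⟩ := he1 x hx y hy h; ⟨b, .inl hb, h⟩
    have e2 : ∀ x ∈ U₂, ∀ y ∈ U₂, G.Adj x y → ∃ b ∈ F1 ∪ F2, x ∈ b ∧ y ∈ b := fun x hx y hy h =>
      let ⟨b, hb, h⟩ := he2 x hx y hy h; ⟨b, .inr hb, h⟩
    rintro x (hx | hx) y (hy | hy) hxy
    · exact e1 x hx y hy hxy
    · rcases hadj x hx y hy hxy with h | h
      exacts [e2 x h y hy hxy, e1 x hx y h hxy]
    · rcases hadj y hy x hx hxy.symm with h | h
      exacts [e2 x hx y h hxy, e1 x h y hy hxy]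
    · exact e2 x hx y hy hxy

/-- Any two vertices of a clique share a bag, so Helly puts the whole clique into one bag, which can
then serve as the root. -/
lemma Decomposable.of_isClique {m : ℕ} {U R K : Set V} (h : Decomposable G m U R) (hK : K ⊆ U)
    (hcl : G.IsClique K) : Decomposable G m U K := by
  obtain ⟨F, hF, hm, he, -⟩ := h
  have hcov : ∀ x ∈ U, ∃ b ∈ F, x ∈ b := by
    clear hm he hK
    induction hF with
    | single b => exact fun x hx => ⟨b, rfl, hx⟩
    | glue _ _ _ _ _ _ ih1 ih2 =>
      rintro x (hx | hx)
      · obtain ⟨b, hb, h⟩ := ih1 x hx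
        exact ⟨b, .inl hb, h⟩
      · obtain ⟨b, hb, h⟩ := ih2 x hx
        exact ⟨b, .inr hb, h⟩
  refine ⟨F, hF, hm, he, hF.helly K hK fun x hx y hy => ?_⟩
  by_cases hxy : x = y
  · subst hxy
    obtain ⟨b, hb, h⟩ := hcov x (hK hx)
    exact ⟨b, hb, h, h⟩
  · exact he x (hK hx) y (hK hy) (hcl hx hy hxy)

/-- Glue decompositions of the components of `W`, together with their neighbourhoods, to a
single central bag. -/
lemma decomposable_star [Finite V] {m : ℕ} {U Ω W : Set V} (hΩ : Ω.ncard ≤ m) (hdis : Disjoint Ω W)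
    (hU : Ω ∪ W ⊆ U)
    (h : ∀ v ∈ W, boundary G U (comp G W v) ⊆ Ω ∧
      Decomposable G m (comp G W v ∪ boundary G U (comp G W v)) (boundary G U (comp G W v))) :
    Decomposable G m (Ω ∪ W) Ω := by
  -- Here `W'` ranges over the unions of components of `W`; each step of the induction peels off one
  -- component.
  suffices H : ∀ n : ℕ, ∀ W' ⊆ W, W'.ncard = n → (∀ x ∈ W', ∀ y ∈ W, G.Adj x y → y ∈ W') →
      Decomposable G m (Ω ∪ W') Ω from H _ W subset_rfl rfl fun _ _ y hy _ => hy
  intro n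
  induction n using Nat.strong_induction_on with
  | _ n ih =>
    intro W' hW' hn hcl
    rcases W'.eq_empty_or_nonempty with rfl | ⟨v, hv⟩
    · rw [Set.union_empty]
      exact Decomposable.of_ncard_le hΩ
    obtain ⟨hb, hd⟩ := h v (hW' hv)
    set D := comp G W v with hD
    have hDW' : D ⊆ W' := comp_subset_of_closed hv hcl
    have hvD : v ∈ D := self_mem_comp W v
    have hDcl : ∀ x ∈ D, ∀ y ∈ W, G.Adj x y → y ∈ D := fun x hx y hy hxy => comp_closed hx hy hxy
    have h1 := ih (W' \ D).ncard
      (hn ▸ Set.ncard_lt_ncard ⟨Set.sdiff_subset, fun hh => (hh hv).2 hvD⟩)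
      (W' \ D) (Set.sdiff_subset.trans hW') rfl
      (fun x hx y hy hxy => ⟨hcl x hx.1 y hy hxy, fun hyD => hx.2
        (hDcl y hyD x (hW' hx.1) hxy.symm)⟩)
    have hdisj : ∀ x ∈ Ω, x ∉ W := fun x hx hxW => Set.disjoint_left.1 hdis hx hxW
    have hint : (Ω ∪ W' \ D) ∩ (D ∪ boundary G U D) ⊆ boundary G U D := by
      rintro x ⟨hx | hx, hx' | hx'⟩
      · exact absurd (hW' (hDW' hx')) (hdisj x hx)
      · exact hx'
      · exact absurd hx' hx.2
      · exact hx'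
    have := h1.glue hd (hint.trans hb) hint (by
      rintro x hx y (hy | hy) hxy
      · left
        by_cases hxD : x ∈ D
        · exact .inl hxD
        · exact .inr ⟨hU (hx.imp id fun h => hW' h.1), hxD, y, hy, hxy⟩
      · exact .inr (.inl (hb hy)))
    convert this using 1
    ext x
    constructor
    · rintro (hx | hx)
      · exact .inl (.inl hx)
      · by_cases hxD : x ∈ D
        exacts [.inr (.inl hxD), .inl (.inr ⟨hx, hxD⟩)]
    · rintro ((hx | hx) | (hx | hx))
      exacts [.inl hx, .inr hx.1, .inr (hDW' hx), .inl (hb hx)]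

end BagFamily

/-! ### From bounded separators to small bags. -/

section Separators

variable {V : Type u} {G : SimpleGraph V}

lemma SepBounded.ncard_le [Finite V] {s : ℕ} (h : SepBounded G s) {A B T : Set V}
    (hA : SetConn G A) (hB : SetConn G B) (hAB : Disjoint A B)
    (hn : ∀ a ∈ A, ∀ b ∈ B, ¬ G.Adj a b) (hT : T ⊆ commonNbrs G A B) : T.ncard ≤ s :=
  (Set.ncard_le_ncard hT).trans (h A B hA hB hAB hn)

/-- The set `A` is connected, lies in `U`, avoids `C` and its neighbourhood, and every vertex of the
neighbourhood of `C` in `U` has a neighbour in `A`. -/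
structure IsOpposite (G : SimpleGraph V) (U C A : Set V) : Prop where
  subset : A ⊆ U
  conn : SetConn G A
  disjoint : Disjoint A C
  disjoint_boundary : Disjoint A (boundary G U C)
  full : ∀ v ∈ boundary G U C, ∃ a ∈ A, G.Adj v a

lemma IsOpposite.not_adj {U C A : Set V} (h : IsOpposite G U C A) :
    ∀ a ∈ A, ∀ c ∈ C, ¬ G.Adj a c := fun _ ha c hc hac =>
  Set.disjoint_left.1 h.disjoint_boundary ha
    ⟨h.subset ha, Set.disjoint_left.1 h.disjoint ha, c, hc, hac⟩

/-- `U` has no clique separator which is the neighbourhood of a connected set. -/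
def IsAtom (G : SimpleGraph V) (U : Set V) : Prop :=
  ∀ C ⊆ U, SetConn G C → G.IsClique (boundary G U C) → U ⊆ C ∪ boundary G U C

lemma exists_not_adj_of_not_isClique {S : Set V} (h : ¬ G.IsClique S) :
    ∃ x ∈ S, ∃ y ∈ S, x ≠ y ∧ ¬ G.Adj x y := by
  by_contra! hc
  exact h fun x hx y hy hxy => hc x hx y hy hxy

lemma disjoint_boundary_comp {U W : Set V} {v : V} : Disjoint (boundary G U (comp G W v)) W := by
  rw [Set.disjoint_left]
  rintro x ⟨_, hx, c, hc, hxc⟩ hxW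
  exact hx (comp_closed hc hxW hxc.symm)

/-- Induction on the size of `C`, with `A` free to grow: the part of `C` cut away, or the vertex
`x`, helps to form the opposite set of each smaller component. -/
lemma decomposable_of_isOpposite [Finite V] {m s : ℕ} (hs : SepBounded G s) (hm : 2 * s ≤ m)
    {U : Set V} (hatom : IsAtom G U) {C A : Set V} (hCU : C ⊆ U) (hC : SetConn G C)
    (hA : IsOpposite G U C A) : Decomposable G m (C ∪ boundary G U C) (boundary G U C) := by
  induction hn : C.ncard using Nat.strong_induction_on generalizing C A with
  | _ n ih =>
  subst hn
  set S := boundary G U C with hS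
  have hSU : S ⊆ U := fun x hx => hx.1
  have hSC : ∀ x ∈ S, x ∉ C := fun x hx => hx.2.1
  have hAC : ∀ x ∈ A, x ∉ C := fun x hx => Set.disjoint_left.1 hA.disjoint hx
  have hAS : ∀ x ∈ A, x ∉ S := fun x hx => Set.disjoint_left.1 hA.disjoint_boundary hx
  have hScard : S.ncard ≤ s := hs.ncard_le hA.conn hC hA.disjoint hA.not_adj
    fun x hx => ⟨hA.full x hx, hx.2.2⟩
  have hncl : ¬ G.IsClique S := by
    intro hcl
    obtain ⟨a, ha⟩ := hA.conn.1
    rcases hatom C hCU hC hcl (hA.subset ha) with h | h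
    exacts [hAC a ha h, hAS a ha h]
  obtain ⟨x, hx, y, hy, hxy, hnxy⟩ := exists_not_adj_of_not_isClique hncl
  set Y := comp G {z | z ∈ C ∧ ¬ G.Adj x z} y with hY
  have hyY : y ∈ Y := self_mem_comp _ _
  have hYC : ∀ z ∈ Y, z = y ∨ z ∈ C ∧ ¬ G.Adj x z := fun z hz => comp_subset _ _ hz
  have hYx : ∀ z ∈ Y, ¬ G.Adj x z := by
    intro z hz
    rcases hYC z hz with rfl | h
    exacts [hnxy, h.2]
  have hYconn : SetConn G Y := setConn_comp _ _
  -- `Y` stops only at neighbours of `x`, so `T` consists of common neighbours of `{x}` and `Y`.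
  set T := {z | z ∈ C ∧ z ∉ Y ∧ ∃ c ∈ Y, G.Adj z c} with hT
  have hTC : T ⊆ C := fun z hz => hz.1
  have hTx : ∀ z ∈ T, G.Adj x z := by
    rintro z ⟨hzC, hzY, c, hc, hzc⟩
    by_contra hxz
    exact hzY (comp_closed hc ⟨hzC, hxz⟩ hzc.symm)
  have hxY : x ∉ Y := by
    intro h
    rcases hYC x h with h | h
    exacts [hxy h, hSC x hx h.1]
  have hTcard : T.ncard ≤ s := hs.ncard_le (SetConn.singleton x) hYconn
    (Set.disjoint_singleton_left.2 hxY) (by rintro _ rfl; exact hYx)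
    fun z hz => ⟨⟨x, rfl, (hTx z hz).symm⟩, hz.2.2⟩
  -- This makes the components of `C \ T` smaller than `C`. If `T` were empty, `Y` would swallow
  -- `C`, although `x` has a neighbour in `C` and none in `Y`.
  have hTne : T.Nonempty := by
    by_contra hTe
    rw [Set.not_nonempty_iff_eq_empty] at hTe
    have hcl : ∀ z ∈ C, ∀ c ∈ Y, G.Adj z c → z ∈ Y := by
      intro z hz c hc hzc
      by_contra hzY
      exact (hTe ▸ (⟨hz, hzY, c, hc, hzc⟩ : z ∈ T) : z ∈ (∅ : Set V))
    obtain ⟨c, hc, hyc⟩ := hy.2.2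
    have hCY := hC.2 (C ∩ Y) Set.inter_subset_left ⟨c, hc, hcl c hc y hyY hyc.symm⟩
      fun z hz w hw hzw => ⟨hw, hcl w hw z hz.2 hzw.symm⟩
    obtain ⟨d, hd, hxd⟩ := hx.2.2
    exact hYx d (hCY hd).2 hxd
  have key := decomposable_star (G := G) (m := m) (U := U) (Ω := S ∪ T) (W := C \ T)
    ((Set.ncard_union_le _ _).trans (by omega))
    (by
      rw [Set.disjoint_left]
      rintro z (hz | hz) hz'
      exacts [hSC z hz hz'.1, hz'.2 hz])
    (by
      rintro z ((hz | hz) | hz)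
      exacts [hSU hz, hCU (hTC hz), hCU hz.1]) ?_
  · have e : S ∪ T ∪ C \ T = C ∪ S := by
      ext z
      by_cases hz : z ∈ T
      · simp [hz, hTC hz]
      · simp [hz, or_comm]
    rw [e] at key
    obtain ⟨F, h1, h2, h3, b, hb, hb'⟩ := key
    exact ⟨F, h1, h2, h3, b, hb, Set.subset_union_left.trans hb'⟩
  · intro v hv
    set D := comp G (C \ T) v with hD
    have hDW : D ⊆ C \ T := comp_subset_of_mem hv
    have hDconn : SetConn G D := setConn_comp _ _
    have hbd : boundary G U D ⊆ S ∪ T := by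
      intro z hz
      by_cases hzC : z ∈ C
      · right
        by_contra hzT
        exact Set.disjoint_left.1 disjoint_boundary_comp hz ⟨hzC, hzT⟩
      · obtain ⟨hzU, -, c, hc, hzc⟩ := hz
        exact .inl ⟨hzU, hzC, c, (hDW hc).1, hzc⟩
    refine ⟨hbd, ?_⟩
    have hlt : D.ncard < C.ncard := by
      refine Set.ncard_lt_ncard ⟨fun z hz => (hDW hz).1, fun h => ?_⟩
      obtain ⟨t, ht⟩ := hTne
      exact (hDW (h (hTC ht))).2 ht
    have hYD : (Y ∩ D).Nonempty → D ⊆ Y := fun hne =>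
      (hDconn.2 (Y ∩ D) Set.inter_subset_right hne fun p hp r hr hpr => by
        refine ⟨?_, hr⟩
        by_contra hrY
        exact (hDW hr).2 ⟨(hDW hr).1, hrY, p, hp.1, hpr.symm⟩).trans Set.inter_subset_left
    have hAD : ∀ z ∈ A, z ∉ D := fun z hz hzD => hAC z hz (hDW hzD).1
    have hAbd : ∀ z ∈ A, z ∉ boundary G U D := by
      intro z hz hzb
      rcases hbd hzb with h | h
      exacts [hAS z hz h, hAC z hz (hTC h)]
    -- If `D` sees `y`, then `D ⊆ Y`, so `D` does not see `x` and `A ∪ {x}` is opposite to `D`.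
    -- Otherwise `D` avoids `Y`, and `A ∪ Y` is opposite to `D`. Either way `S` is seen from `A`,
    -- and `T` from `x` or from `Y`.
    by_cases hyb : y ∈ boundary G U D
    · have hDY : D ⊆ Y := by
        obtain ⟨-, -, c, hc, hyc⟩ := hyb
        refine hYD ⟨c, ?_, hc⟩
        by_contra hcY
        exact (hDW hc).2 ⟨(hDW hc).1, hcY, y, hyY, hyc.symm⟩
      have hxb : x ∉ boundary G U D := fun ⟨_, _, c, hc, hxc⟩ => hYx c (hDY hc) hxc
      obtain ⟨a, ha, hxa⟩ := hA.full x hx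
      refine ih _ hlt (fun z hz => hCU (hDW hz).1) hDconn (A := A ∪ {x}) ⟨?_, ?_, ?_, ?_, ?_⟩ rfl
      · exact Set.union_subset hA.subset (Set.singleton_subset_iff.2 (hSU hx))
      · exact hA.conn.union (SetConn.singleton x) ha rfl hxa.symm
      · rw [Set.disjoint_left]
        rintro z (hz | rfl) hzD
        exacts [hAD z hz hzD, hSC _ hx (hDW hzD).1]
      · rw [Set.disjoint_left]
        rintro z (hz | rfl) hzb
        exacts [hAbd z hz hzb, hxb hzb]
      · intro z hz
        rcases hbd hz with h | h
        · obtain ⟨a, ha, h⟩ := hA.full z h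
          exact ⟨a, .inl ha, h⟩
        · exact ⟨x, .inr rfl, (hTx z h).symm⟩
    · obtain ⟨a, ha, hya⟩ := hA.full y hy
      have hDYd : ∀ z ∈ Y, z ∉ D := by
        intro z hz hzD
        have hDY := hYD ⟨z, hz, hzD⟩
        refine hSC y hy (hDW (hYconn.2 D hDY hDconn.1 (fun p hp r hr hpr => ?_) hyY)).1
        rcases hYC r hr with rfl | hrC
        · refine absurd ⟨hSU hy, fun h => hSC _ hy (hDW h).1, p, hp, hpr.symm⟩ hyb
        · exact comp_closed hp ⟨hrC.1, fun h => h.2.1 hr⟩ hpr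
      refine ih _ hlt (fun z hz => hCU (hDW hz).1) hDconn (A := A ∪ Y) ⟨?_, ?_, ?_, ?_, ?_⟩ rfl
      · refine Set.union_subset hA.subset fun z hz => ?_
        rcases hYC z hz with rfl | h
        exacts [hSU hy, hCU h.1]
      · exact hA.conn.union hYconn ha hyY hya.symm
      · rw [Set.disjoint_left]
        rintro z (hz | hz) hzD
        exacts [hAD z hz hzD, hDYd z hz hzD]
      · rw [Set.disjoint_left]
        rintro z (hz | hz) hzb
        · exact hAbd z hz hzb
        · rcases hbd hzb with h | h
          · rcases hYC z hz with rfl | h'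
            exacts [hyb hzb, hSC z h h'.1]
          · exact h.2.1 hz
      · intro z hz
        rcases hbd hz with h | h
        · obtain ⟨a, ha, h⟩ := hA.full z h
          exact ⟨a, .inl ha, h⟩
        · obtain ⟨c, hc, h⟩ := h.2.2
          exact ⟨c, .inr hc, h⟩

/-- The recursion starts from the neighbourhood `S` of a component `Y` of the non-neighbours of some
`x`. As `S` lies in the neighbourhood of `x`, both `{x}` and `Y` see all of it, and every component
of `U \ S` is opposite to one of the two. -/
lemma IsAtom.decomposable [Finite V] {m s : ℕ} (hs : SepBounded G s) (hm : 2 * s ≤ m)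
    (hcl : ∀ K : Set V, G.IsClique K → K.ncard ≤ m) {U : Set V} (hatom : IsAtom G U) :
    Decomposable G m U ∅ := by
  have weaken : ∀ {R}, Decomposable G m U R → Decomposable G m U ∅ :=
    fun ⟨F, h1, h2, h3, b, hb, _⟩ => ⟨F, h1, h2, h3, b, hb, Set.empty_subset _⟩
  by_cases hU : G.IsClique U
  · exact weaken (Decomposable.of_ncard_le (hcl U hU))
  obtain ⟨x, hx, y, hy, hxy, hnxy⟩ := exists_not_adj_of_not_isClique hU
  set W₀ := {z | z ∈ U ∧ z ≠ x ∧ ¬ G.Adj x z} with hW₀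
  have hyW : y ∈ W₀ := ⟨hy, hxy.symm, hnxy⟩
  set Y := comp G W₀ y with hY
  have hYW : Y ⊆ W₀ := comp_subset_of_mem hyW
  have hYconn : SetConn G Y := setConn_comp _ _
  set S := boundary G U Y with hS
  have hSx : ∀ z ∈ S, G.Adj x z := by
    intro z hz
    by_contra hxz
    refine Set.disjoint_left.1 disjoint_boundary_comp hz ⟨hz.1, ?_, hxz⟩
    rintro rfl
    obtain ⟨-, -, c, hc, hzc⟩ := hz
    exact (hYW hc).2.2 hzc
  have hxY : x ∉ Y := fun h => (hYW h).2.1 rfl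
  have hxS : x ∉ S := fun h => (hSx x h).ne rfl
  have hScard : S.ncard ≤ s := hs.ncard_le (SetConn.singleton x) hYconn
    (Set.disjoint_singleton_left.2 hxY) (by rintro _ rfl z hz; exact (hYW hz).2.2)
    fun z hz => ⟨⟨x, rfl, (hSx z hz).symm⟩, hz.2.2⟩
  have hSU : S ⊆ U := fun z hz => hz.1
  have hYS : ∀ z ∈ Y, z ∉ S := fun z hz h => h.2.1 hz
  have key := decomposable_star (G := G) (m := m) (U := U) (Ω := S) (W := U \ S) (by omega)
    Set.disjoint_sdiff_right (Set.union_subset hSU Set.sdiff_subset) ?_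
  · rw [Set.union_sdiff_cancel hSU] at key
    exact weaken key
  intro v hv
  set D := comp G (U \ S) v with hD
  have hDW : D ⊆ U \ S := comp_subset_of_mem hv
  have hDconn : SetConn G D := setConn_comp _ _
  have hbd : boundary G U D ⊆ S := by
    intro z hz
    by_contra hzS
    exact Set.disjoint_left.1 disjoint_boundary_comp hz ⟨hz.1, hzS⟩
  refine ⟨hbd, ?_⟩
  by_cases hxD : x ∈ D
  · refine decomposable_of_isOpposite hs hm hatom (fun z hz => (hDW hz).1) hDconn
      (A := Y) ⟨fun z hz => (hYW hz).1, hYconn, ?_, ?_, fun z hz => (hbd hz).2.2⟩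
    · rw [Set.disjoint_left]
      intro z hzY hzD
      have := hDconn.2 (Y ∩ D) Set.inter_subset_right ⟨z, hzY, hzD⟩ fun p hp r hr hpr => by
        refine ⟨?_, hr⟩
        by_contra hrY
        exact (hDW hr).2 ⟨(hDW hr).1, hrY, p, hp.1, hpr.symm⟩
      exact hxY (this hxD).1
    · exact Set.disjoint_left.2 fun z hz hzb => hYS z hz (hbd hzb)
  · exact decomposable_of_isOpposite hs hm hatom (fun z hz => (hDW hz).1) hDconn
      (A := {x}) ⟨Set.singleton_subset_iff.2 hx, .singleton x, Set.disjoint_singleton_left.2 hxD,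
        Set.disjoint_singleton_left.2 fun h => hxS (hbd h),
        fun z hz => ⟨x, rfl, (hSx z (hbd hz)).symm⟩⟩

/-- Skodinis' bound: a graph whose minimal separators have size at most `s` has a tree
decomposition into bags of size at most `max (ω(G)) (2 * s)`. -/
lemma SepBounded.decomposable [Finite V] {m s : ℕ} (hs : SepBounded G s) (hm : 2 * s ≤ m)
    (hcl : ∀ K : Set V, G.IsClique K → K.ncard ≤ m) (U : Set V) : Decomposable G m U ∅ := by
  induction hn : U.ncard using Nat.strong_induction_on generalizing U with
  | _ n ih =>
  subst hn
  by_cases hatom : IsAtom G U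
  · exact hatom.decomposable hs hm hcl
  simp only [IsAtom, not_forall] at hatom
  obtain ⟨C, hCU, hC, hK, hne⟩ := hatom
  set S := boundary G U C with hS
  have hSU : S ⊆ U := fun z hz => hz.1
  -- The clique `S` separates `C` from the rest; both sides, taken with `S`, are smaller than `U`.
  have h1 := ih (C ∪ S).ncard
    (Set.ncard_lt_ncard ⟨Set.union_subset hCU hSU, hne⟩) (C ∪ S) rfl
  have h2 := ih (U \ C).ncard (Set.ncard_lt_ncard ⟨Set.sdiff_subset, fun h => by
    obtain ⟨c, hc⟩ := hC.1
    exact (h (hCU hc)).2 hc⟩) (U \ C) rfl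
  have hi : (C ∪ S) ∩ (U \ C) ⊆ S := fun z hz => hz.1.resolve_left hz.2.2
  have h := (h1.of_isClique Set.subset_union_right hK).glue
    (h2.of_isClique (fun z hz => ⟨hz.1, hz.2.1⟩) hK) hi hi (by
      rintro p (hp | hp) r hr hpr
      · exact .inr (.inr ⟨hr.1, hr.2, p, hp, hpr.symm⟩)
      · exact .inl ⟨hp.1, hp.2.1⟩)
  have e : C ∪ S ∪ U \ C = U := by
    ext z
    constructor
    · rintro ((h | h) | h)
      exacts [hCU h, hSU h, h.1]
    · intro h
      by_cases hz : z ∈ C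
      exacts [.inl (.inl hz), .inr ⟨h, hz⟩]
  rw [e] at h
  obtain ⟨F, h1, h2, h3, b, hb, _⟩ := h
  exact ⟨F, h1, h2, h3, b, hb, Set.empty_subset _⟩

end Separators

/-! ### Realising a bag family by an actual tree. -/

section Trees

open SimpleGraph

lemma isAcyclic_sum {N₁ : Type u} {N₂ : Type v} {T₁ : SimpleGraph N₁} {T₂ : SimpleGraph N₂}
    (h1 : T₁.IsAcyclic) (h2 : T₂.IsAcyclic) : (T₁ ⊕g T₂).IsAcyclic := by
  rw [isAcyclic_iff_forall_adj_isBridge] at *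
  -- A walk in the sum stays in one summand, so an edge that is a bridge there remains a bridge in
  -- the sum.
  have aux : ∀ x y z : N₁ ⊕ N₂, ((T₁ ⊕g T₂).deleteEdges {s(x, y)}).Reachable x z →
      (∃ a b, x = .inl a ∧ z = .inl b ∧ ∀ c, y = .inl c → (T₁.deleteEdges {s(a, c)}).Reachable a b) ∨
      ∃ a b, x = .inr a ∧ z = .inr b ∧ ∀ c, y = .inr c → (T₂.deleteEdges {s(a, c)}).Reachable a b := by
    intro x y z hz
    rw [reachable_iff_reflTransGen] at hz
    induction hz with
    | refl =>
      rcases x with a | a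
      exacts [.inl ⟨a, a, rfl, rfl, fun _ _ => .refl _⟩, .inr ⟨a, a, rfl, rfl, fun _ _ => .refl _⟩]
    | @tail p q _ hpq ih =>
      rcases ih with ⟨a, b, rfl, rfl, ih⟩ | ⟨a, b, rfl, rfl, ih⟩ <;> rcases q with q | q
      · refine .inl ⟨a, q, rfl, rfl, fun c hc => (ih c hc).trans (Adj.reachable ?_)⟩
        subst hc
        simpa using hpq
      · simp at hpq
      · simp at hpq
      · refine .inr ⟨a, q, rfl, rfl, fun c hc => (ih c hc).trans (Adj.reachable ?_)⟩
        subst hc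
        simpa using hpq
  intro x y hxy
  rw [isBridge_iff]
  intro hr
  rcases aux x y y hr with ⟨a, b, rfl, rfl, h⟩ | ⟨a, b, rfl, rfl, h⟩
  · exact isBridge_iff.1 (h1 (by simpa using hxy)) (h b rfl)
  · exact isBridge_iff.1 (h2 (by simpa using hxy)) (h b rfl)

lemma isTree_sum_sup_edge {N₁ : Type u} {N₂ : Type v} {T₁ : SimpleGraph N₁} {T₂ : SimpleGraph N₂}
    (h1 : T₁.IsTree) (h2 : T₂.IsTree) (t₁ : N₁) (t₂ : N₂) :
    ((T₁ ⊕g T₂) ⊔ edge (.inl t₁) (.inr t₂)).IsTree :=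
  ⟨h1.connected.sum_sup_edge h2.connected,
    (isAcyclic_sum h1.isAcyclic h2.isAcyclic).sup_edge_of_not_reachable
      (not_reachable_sum_inl_inr _ _)⟩

lemma connected_induce_image {N : Type u} {N' : Type v} {T : SimpleGraph N} {T' : SimpleGraph N'}
    (f : T →g T') {s : Set N} (h : (T.induce s).Connected) : (T'.induce (f '' s)).Connected :=
  h.map (f := (⟨fun x => ⟨f x, x, x.2, rfl⟩, fun hab => f.map_adj hab⟩ :
    T.induce s →g T'.induce (f '' s))) (by rintro ⟨_, x, hx, rfl⟩; exact ⟨⟨x, hx⟩, rfl⟩)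

/-- A bag family is the family of bags of an honest tree decomposition. -/
lemma BagFamily.exists_tree {V : Type u} {U : Set V} {F : Set (Set V)} (h : BagFamily U F) :
    ∃ (N : Type) (_ : Finite N) (T : SimpleGraph N) (bag : N → Set V), T.IsTree ∧
      Set.range bag = F ∧ ∀ a ∈ U, (T.induce {t | a ∈ bag t}).Connected := by
  induction h with
  | single b =>
    refine ⟨Unit, inferInstance, ⊥, fun _ => b, .of_subsingleton, Set.range_const, fun a ha => ?_⟩
    have : Nonempty {t : Unit | a ∈ b} := ⟨⟨(), ha⟩⟩
    exact .of_subsingleton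
  | @glue U₁ U₂ F₁ F₂ c₁ c₂ h1 h2 hc1 hc2 hs1 hs2 ih1 ih2 =>
    obtain ⟨N₁, _, T₁, bag₁, hT1, rfl, hcon1⟩ := ih1
    obtain ⟨N₂, _, T₂, bag₂, hT2, rfl, hcon2⟩ := ih2
    obtain ⟨t₁, rfl⟩ := hc1
    obtain ⟨t₂, rfl⟩ := hc2
    refine ⟨N₁ ⊕ N₂, inferInstance, (T₁ ⊕g T₂) ⊔ edge (.inl t₁) (.inr t₂), Sum.elim bag₁ bag₂,
      isTree_sum_sup_edge hT1 hT2 t₁ t₂, Set.Sum.elim_range _ _, fun a ha => ?_⟩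
    let f₁ : T₁ →g (T₁ ⊕g T₂) ⊔ edge (.inl t₁) (.inr t₂) :=
      (Hom.ofLE le_sup_left).comp Embedding.sumInl.toHom
    let f₂ : T₂ →g (T₁ ⊕g T₂) ⊔ edge (.inl t₁) (.inr t₂) :=
      (Hom.ofLE le_sup_left).comp Embedding.sumInr.toHom
    have e : {t | a ∈ Sum.elim bag₁ bag₂ t} = f₁ '' {t | a ∈ bag₁ t} ∪ f₂ '' {t | a ∈ bag₂ t} := by
      ext (t | t) <;> simp [f₁, f₂]
    have hsub1 : ∀ t, bag₁ t ⊆ U₁ := fun t => h1.subset _ ⟨t, rfl⟩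
    have hsub2 : ∀ t, bag₂ t ⊆ U₂ := fun t => h2.subset _ ⟨t, rfl⟩
    rw [e]
    by_cases ha1 : a ∈ U₁ <;> by_cases ha2 : a ∈ U₂
    · refine connected_induce_union (connected_induce_image f₁ (hcon1 a ha1)).preconnected
        (connected_induce_image f₂ (hcon2 a ha2)).preconnected
        (v := .inl t₁) (w := .inr t₂) ⟨t₁, hs1 ⟨ha1, ha2⟩, rfl⟩ ⟨t₂, hs2 ⟨ha1, ha2⟩, rfl⟩ ?_
      simp [edge]
    · have : {t | a ∈ bag₂ t} = ∅ := Set.eq_empty_of_forall_notMem fun t ht => ha2 (hsub2 t ht)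
      rw [this, Set.image_empty, Set.union_empty]
      exact connected_induce_image f₁ (hcon1 a ha1)
    · have : {t | a ∈ bag₁ t} = ∅ := Set.eq_empty_of_forall_notMem fun t ht => ha1 (hsub1 t ht)
      rw [this, Set.image_empty, Set.empty_union]
      exact connected_induce_image f₂ (hcon2 a ha2)
    · exact absurd ha (by simp [ha1, ha2])

lemma Decomposable.treewidth_le {V : Type u} {G : SimpleGraph V} {m : ℕ} {R : Set V}
    (h : Decomposable G m Set.univ R) : treewidth G ≤ m - 1 := by
  obtain ⟨F, hF, hm, he, -⟩ := h
  obtain ⟨N, hN, T, bag, hT, rfl, hcon⟩ := hF.exists_tree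
  have hne : Nonempty N := hT.connected.nonempty
  let D : TreeDecomposition G :=
    { Node := N
      finite_node := hN
      tree := T
      isTree := hT
      bag := bag
      iUnion_bag := Set.eq_univ_of_forall fun a => by
        obtain ⟨⟨t, ht⟩⟩ := (hcon a trivial).nonempty
        exact Set.mem_iUnion.2 ⟨t, ht⟩
      exists_bag_of_adj := fun a b hab => by
        obtain ⟨_, ⟨t, rfl⟩, h⟩ := he a trivial b trivial hab
        exact ⟨t, h⟩
      connected_nodes := fun a => hcon a trivial }
  have hD : D.width ≤ m - 1 := Nat.sub_le_sub_right (ciSup_le fun t => hm _ ⟨t, rfl⟩) 1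
  exact (Nat.sInf_le (show ∃ D' : TreeDecomposition G, D'.width = D.width from ⟨D, rfl⟩)).trans hD

end Trees

/-! ### Finiteness of Ramsey numbers. -/

section Ramsey

lemma exists_ramsey (k l : ℕ) : ∃ N : ℕ, ∀ (V : Type) (G : SimpleGraph V) (S : Finset V),
    N ≤ S.card → (∃ t ⊆ S, G.IsNClique k t) ∨ ∃ t ⊆ S, G.IsNIndepSet l t := by
  classical
  induction hn : k + l generalizing k l with
  | zero => exact ⟨0, fun V G S _ => .inl ⟨∅, by simp, by simp; omega⟩⟩
  | succ n ih =>
    rcases k with _ | k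
    · exact ⟨0, fun V G S _ => .inl ⟨∅, by simp, by simp⟩⟩
    rcases l with _ | l
    · exact ⟨0, fun V G S _ => .inr ⟨∅, by simp, by
        simp [SimpleGraph.isNIndepSet_iff, SimpleGraph.IsIndepSet]⟩⟩
    obtain ⟨N₁, h1⟩ := ih k (l + 1) (by omega)
    obtain ⟨N₂, h2⟩ := ih (k + 1) l (by omega)
    -- Pigeonhole: without `v`, at least `N₁ + N₂` vertices are split into neighbours and
    -- non-neighbours of `v`.
    refine ⟨N₁ + N₂ + 1, fun V G S hS => ?_⟩
    obtain ⟨v, hv⟩ : S.Nonempty := Finset.card_pos.1 (by omega)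
    have hA : (S.erase v).filter (G.Adj v) ⊆ S :=
      (Finset.filter_subset _ _).trans (Finset.erase_subset _ _)
    have hB : (S.erase v).filter (fun w => ¬ G.Adj v w) ⊆ S :=
      (Finset.filter_subset _ _).trans (Finset.erase_subset _ _)
    have hcard := Finset.card_filter_add_card_filter_not (s := S.erase v) (G.Adj v)
    rw [Finset.card_erase_of_mem hv] at hcard
    by_cases hc : N₁ ≤ ((S.erase v).filter (G.Adj v)).card
    · rcases h1 V G _ hc with ⟨t, ht, hk⟩ | ⟨t, ht, hk⟩
      · refine .inl ⟨insert v t, Finset.insert_subset hv (ht.trans hA), hk.insert fun b hb => ?_⟩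
        exact (Finset.mem_filter.1 (ht hb)).2
      · exact .inr ⟨t, ht.trans hA, hk⟩
    · rcases h2 V G ((S.erase v).filter (fun w => ¬ G.Adj v w)) (by omega) with
        ⟨t, ht, hk⟩ | ⟨t, ht, hk⟩
      · exact .inl ⟨t, ht.trans hB, hk⟩
      · refine .inr ⟨insert v t, Finset.insert_subset hv (ht.trans hB), ?_⟩
        rw [← SimpleGraph.isNClique_compl] at hk ⊢
        refine hk.insert fun b hb => ?_
        have := Finset.mem_filter.1 (ht hb)
        exact (SimpleGraph.compl_adj _ _ _).2 ⟨(Finset.ne_of_mem_erase this.1).symm, this.2⟩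

lemma ramseyNumber_spec (k l : ℕ) : 0 < ramseyNumber k l ∧
    ∀ n : ℕ, ramseyNumber k l ≤ n → ∀ G : SimpleGraph (Fin n),
      (∃ s : Finset (Fin n), G.IsNClique k s) ∨ ∃ s : Finset (Fin n), G.IsNIndepSet l s := by
  -- The infimum of an empty set would be `0`; existence of Ramsey numbers shows that it is
  -- attained.
  refine Nat.sInf_mem (s := {N : ℕ | 0 < N ∧ ∀ n : ℕ, N ≤ n → ∀ G : SimpleGraph (Fin n),
    (∃ s : Finset (Fin n), G.IsNClique k s) ∨ ∃ s : Finset (Fin n), G.IsNIndepSet l s}) ?_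
  obtain ⟨N, hN⟩ := exists_ramsey k l
  refine ⟨N + 1, by omega, fun n hn G => ?_⟩
  rcases hN (Fin n) G Finset.univ (by simp; omega) with ⟨t, _, h⟩ | ⟨t, _, h⟩
  exacts [.inl ⟨t, h⟩, .inr ⟨t, h⟩]

/-- A set of at least `R(k, l)` vertices contains the injective image of `k` pairwise adjacent or
`l` pairwise nonadjacent points. -/
lemma exists_of_ramseyNumber_le_ncard {V : Type u} [Finite V] (G : SimpleGraph V) {k l : ℕ}
    {S : Set V} (hS : ramseyNumber k l ≤ S.ncard) :
    (∃ t : Finset V, ↑t ⊆ S ∧ G.IsNClique k t) ∨ ∃ t : Finset V, ↑t ⊆ S ∧ G.IsNIndepSet l t := by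
  classical
  have e : Fin S.ncard ≃ S := (Finite.equivFinOfCardEq rfl).symm
  let f : Fin S.ncard ↪ V := e.toEmbedding.trans (Function.Embedding.subtype _)
  have hf : ∀ s : Finset (Fin S.ncard), ↑(s.map f) ⊆ S := by
    intro s x hx
    obtain ⟨i, -, rfl⟩ := Finset.mem_map.1 hx
    exact (e i).2
  rcases (ramseyNumber_spec k l).2 _ hS (G.comap f) with ⟨s, hs⟩ | ⟨s, hs⟩
  · exact .inl ⟨s.map f, hf s, (hs.map (f := f)).mono (SimpleGraph.map_comap_le f G)⟩
  · refine .inr ⟨s.map f, hf s, ⟨?_, by rw [Finset.card_map, hs.card_eq]⟩⟩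
    intro x hx y hy hxy
    obtain ⟨i, hi, rfl⟩ := Finset.mem_map.1 hx
    obtain ⟨j, hj, rfl⟩ := Finset.mem_map.1 hy
    exact hs.isIndepSet hi hj fun h => hxy (h ▸ rfl)

end Ramsey

/-! ### Excluding `K_{2,q}` bounds the separators. -/

section Main

lemma setConn_image_val {V : Type u} {G : SimpleGraph V} {S : Set V} {A : Set S}
    (h : SetConn (G.induce S) A) : SetConn G (Subtype.val '' A) := by
  refine ⟨h.1.image _, ?_⟩
  rintro X hX ⟨z, hz⟩ hcl
  obtain ⟨w, hw, rfl⟩ := hX hz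
  have := h.2 (Subtype.val ⁻¹' X ∩ A) Set.inter_subset_right ⟨w, hz, hw⟩
    fun x hx y hy hxy => ⟨hcl x hx.1 y ⟨y, hy, rfl⟩ hxy, hy⟩
  rintro _ ⟨a, ha, rfl⟩
  exact (this ha).1

/-- The bags are `A`, `B` and the singletons of `t`. Common neighbours lie outside `A ∪ B` because
there are no edges between `A` and `B`. -/
lemma isInducedMinor_of_commonNbrs {V : Type u} {G : SimpleGraph V} {A B : Set V}
    (hA : SetConn G A) (hB : SetConn G B) (hdis : Disjoint A B)
    (hn : ∀ a ∈ A, ∀ b ∈ B, ¬ G.Adj a b) {q : ℕ} {t : Finset V} (ht : ↑t ⊆ commonNbrs G A B)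
    (hq : G.IsNIndepSet q t) : IsInducedMinor (completeBipartiteGraph (Fin 2) (Fin q)) G := by
  let e : Fin q ≃ t := (t.equivFinOfCardEq hq.card_eq).symm
  have htA : ∀ i, (e i : V) ∉ A := fun i hi =>
    let ⟨b, hb, h⟩ := (ht (e i).2).2
    hn _ hi b hb h
  have htB : ∀ i, (e i : V) ∉ B := fun i hi =>
    let ⟨a, ha, h⟩ := (ht (e i).2).1
    hn a ha _ hi h.symm
  have hside : ∀ j : Fin 2, ∀ i, (e i : V) ∉ (if j = 0 then A else B) := by
    intro j i
    split_ifs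
    exacts [htA i, htB i]
  have hnbr : ∀ j : Fin 2, ∀ i, ∃ a ∈ (if j = 0 then A else B), G.Adj (e i) a := by
    intro j i
    split_ifs
    exacts [(ht (e i).2).1, (ht (e i).2).2]
  have hne : ∀ i j, i ≠ j → (e i : V) ≠ e j := fun i j hij h => hij (e.injective (Subtype.ext h))
  have h01 : ∀ i j : Fin 2, i ≠ j → (i = 0 ∧ j = 1) ∨ (i = 1 ∧ j = 0) := by decide
  refine ⟨⟨Sum.elim (fun j : Fin 2 => if j = 0 then A else B) (fun i => {(e i : V)}), ?_, ?_, ?_⟩⟩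
  · rintro (i | i) (j | j) hij
    · rcases h01 i j (by simpa using hij) with ⟨rfl, rfl⟩ | ⟨rfl, rfl⟩
      · simpa using hdis
      · simpa using hdis.symm
    · exact Set.disjoint_singleton_right.2 (hside i j)
    · exact Set.disjoint_singleton_left.2 (hside j i)
    · exact Set.disjoint_singleton.2 (hne i j (by simpa using hij))
  · rintro (i | i)
    · have hj : SetConn G (if i = 0 then A else B) := by
        split_ifs
        exacts [hA, hB]
      exact hj.connected
    · exact (SetConn.singleton _).connected
  · rintro (i | i) (j | j) hij
    · refine iff_of_false ?_ (by simp)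
      rcases h01 i j (by simpa using hij) with ⟨rfl, rfl⟩ | ⟨rfl, rfl⟩
      · rintro ⟨a, ha, b, hb, h⟩
        exact hn a (by simpa using ha) b (by simpa using hb) h
      · rintro ⟨a, ha, b, hb, h⟩
        exact hn b (by simpa using hb) a (by simpa using ha) h.symm
    · refine iff_of_true ?_ (by simp)
      obtain ⟨a, ha, h⟩ := hnbr i j
      exact ⟨a, ha, e j, rfl, h.symm⟩
    · refine iff_of_true ?_ (by simp)
      obtain ⟨a, ha, h⟩ := hnbr j i
      exact ⟨e i, rfl, a, ha, h⟩
    · refine iff_of_false ?_ (by simp)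
      rintro ⟨_, rfl, _, rfl, h⟩
      exact hq.isIndepSet (e i).2 (e j).2 (hne i j (by simpa using hij)) h

lemma sepBounded_induce {V : Type u} [Finite V] {G : SimpleGraph V} {q : ℕ}
    (hG : ¬ IsInducedMinor (completeBipartiteGraph (Fin 2) (Fin q)) G) (S : Set V) :
    SepBounded (G.induce S) (ramseyNumber ((G.induce S).cliqueNum + 1) q - 1) := by
  classical
  intro A B hA hB hdis hn
  by_contra! hlt
  -- A clique of size `ω + 1` is impossible, and an independent set of size `q` gives the forbidden
  -- minor in `G`.
  rcases exists_of_ramseyNumber_le_ncard (G.induce S) (S := commonNbrs (G.induce S) A B)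
    (Nat.le_of_pred_lt hlt) with ⟨t, -, ht⟩ | ⟨t, htS, ht⟩
  · have := ht.isClique.card_le_cliqueNum
    rw [ht.card_eq] at this
    omega
  · refine hG (isInducedMinor_of_commonNbrs (setConn_image_val hA) (setConn_image_val hB)
      ((Set.disjoint_image_iff Subtype.val_injective).2 hdis) ?_
      (t := t.map (Function.Embedding.subtype _)) ?_ ⟨?_, by rw [Finset.card_map, ht.card_eq]⟩)
    · rintro _ ⟨a, ha, rfl⟩ _ ⟨b, hb, rfl⟩
      exact hn a ha b hb
    · intro x hx
      obtain ⟨i, hi, rfl⟩ := Finset.mem_map.1 hx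
      obtain ⟨⟨a, ha, h⟩, b, hb, h'⟩ := htS hi
      exact ⟨⟨a, ⟨a, ha, rfl⟩, h⟩, b, ⟨b, hb, rfl⟩, h'⟩
    · intro x hx y hy hxy
      obtain ⟨i, hi, rfl⟩ := Finset.mem_map.1 hx
      obtain ⟨j, hj, rfl⟩ := Finset.mem_map.1 hy
      exact ht.isIndepSet hi hj fun h => hxy (h ▸ rfl)

lemma isTwOmegaBindingFunction_inducedMinorFree (q : ℕ) :
    IsTwOmegaBindingFunction.{u} (inducedMinorFree (completeBipartiteGraph (Fin 2) (Fin q)))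
      (fun k => max k (2 * ramseyNumber (k + 1) q - 2) - 1) := by
  intro V _ G hG S
  -- With `s = R - 1` the required bound `2 * s` is `2 * R - 2`. The truncated final `- 1` reads the
  -- value `-1` as `0`.
  refine ((sepBounded_induce hG S).decomposable (by omega) (fun K hK => ?_) Set.univ).treewidth_le
  have hK' : (G.induce S).IsClique (K.toFinite.toFinset : Set S) := by simpa using hK
  rw [Set.ncard_eq_toFinset_card K]
  exact hK'.card_le_cliqueNum.trans (le_max_left _ _)

end Main

end TwOmega

theorem mainTheorem7 (q : ℕ) :
    TwOmega.IsTwOmegaBounded.{u}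
        (TwOmega.inducedMinorFree (completeBipartiteGraph (Fin 2) (Fin q))) ∧
      TwOmega.IsTwOmegaBindingFunction.{u}
        (TwOmega.inducedMinorFree (completeBipartiteGraph (Fin 2) (Fin q)))
        (fun k => max k (2 * TwOmega.ramseyNumber (k + 1) q - 2) - 1) :=
  ⟨⟨_, TwOmega.isTwOmegaBindingFunction_inducedMinorFree q⟩,
    TwOmega.isTwOmegaBindingFunction_inducedMinorFree q⟩
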